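/- Let $K$ be a unital commutative $\mathbb{Q}$-algebra, $z=(z_1,\dots,z_n)$ either commutative or noncommutative free variables, and $t$ a central formal parameter. Write $K\langle\langle z\rangle\rangle$ and $K[[t]]\langle\langle z\rangle\rangle$ for the algebras of formal power series in $z$ over $K$ and $K[[t]]$. For $u=(u_1,\dots,u_n)\in K\langle\langle z\rangle\rangle^{\times n}$ let $\left[u\frac{\partial}{\partial z}\right]$ be the $K$-derivation of $K\langle\langle z\rangle\rangle$ with $z_i\mapsto u_i$ for all $i$; it acts on vectors of series componentwise. Let $\alpha\ge 1$, let $H(z)\in K\langle\langle z\rangle\rangle^{\times n}$ have all components of order at least $\alpha$, let $F_t(z)=z-tH(z)$ be the corresponding automorphism of $K[[t]]\langle\langle z\rangle\rangle$ over $K[[t]]$ (so that $z_i\mapsto z_i-tH_i(z)$), and let $G_t=F_t^{-1}$ be its inverse. Define $N_{[m]}(z)\in K\langle\langle z\rangle\rangle^{\times n}$ for $m\ge 1$ by $$G_t(z)=z+\sum_{m\ge 1}t^m N_{[m]}(z).$$ For a composition $I=(i_1,\dots,i_k)$ (a finite sequence of positive integers) put $\ell(I)=k$, $\bar I=(i_k,\dots,i_1)$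 and $\pi_u(I)=\prod_{j=1}^{k}(i_1+\cdots+i_j)$, and let $\mathcal{C}_m$ be the set of compositions with $i_1+\cdots+i_k=m$. Then $N_{[1]}(z)=H(z)$ and, for every $m\ge 2$, $$N_{[m]}(z)=\frac{m}{m-1}\sum_{\substack{I=(i_1,\dots,i_k)\in\mathcal{C}_m\\ \ell(I)\ge 2}}\frac{1}{\pi_u(\bar I)}\left[N_{[i_1]}\frac{\partial}{\partial z}\right]\cdots\left[N_{[i_{k-1}]}\frac{\partial}{\partial z}\right]N_{[i_k]}(z).$$ -/

import Mathlib

open scoped PowerSeries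

/-- Formal power series over `R` in noncommutative free variables `z_i`, `i : σ`. A series is
given by its coefficients: a word `z_{i_1} ⋯ z_{i_k}` is the list `[i_1, …, i_k]`. -/
def NCPowerSeries (σ R : Type*) := List σ → R

namespace NCPowerSeries

section Basic

variable {σ R A : Type*}

instance [AddCommMonoid A] : AddCommMonoid (NCPowerSeries σ A) :=
  inferInstanceAs (AddCommMonoid (List σ → A))

instance [AddCommGroup A] : AddCommGroup (NCPowerSeries σ A) :=
  inferInstanceAs (AddCommGroup (List σ → A))

instance [Semiring R] [AddCommMonoid A] [Module R A] : Module R (NCPowerSeries σ A) :=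
  inferInstanceAs (Module R (List σ → A))

/-- The coefficient of a word in a series. -/
def coeff (w : List σ) (f : NCPowerSeries σ A) : A := f w

@[ext]
theorem ext {f g : NCPowerSeries σ A} (h : ∀ w, coeff w f = coeff w g) : f = g := funext h

@[simp]
theorem coeff_zero [AddCommMonoid A] (w : List σ) : coeff w (0 : NCPowerSeries σ A) = 0 := rfl

@[simp]
theorem coeff_add [AddCommMonoid A] (w : List σ) (f g : NCPowerSeries σ A) :
    coeff w (f + g) = coeff w f + coeff w g := rfl

@[simp]
theorem coeff_smul [Semiring R] [AddCommMonoid A] [Module R A] (w : List σ) (r : R)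
    (f : NCPowerSeries σ A) : coeff w (r • f) = r • coeff w f := rfl

/-- The unit series. -/
instance [Semiring A] : One (NCPowerSeries σ A) := ⟨fun w => if w.length = 0 then 1 else 0⟩

/-- The Cauchy product: the coefficient of `w` in `f * g` is the sum of
`coeff u f * coeff v g` over all ways to cut `w` into a concatenation `u ++ v`. -/
instance [Semiring A] : Mul (NCPowerSeries σ A) :=
  ⟨fun f g w => ∑ k ∈ Finset.range (w.length + 1), coeff (w.take k) f * coeff (w.drop k) g⟩

theorem coeff_one [Semiring A] (w : List σ) :
    coeff w (1 : NCPowerSeries σ A) = if w.length = 0 then 1 else 0 := rfl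

theorem coeff_mul [Semiring A] (w : List σ) (f g : NCPowerSeries σ A) :
    coeff w (f * g) =
      ∑ k ∈ Finset.range (w.length + 1), coeff (w.take k) f * coeff (w.drop k) g := rfl

protected theorem one_mul [Semiring A] (f : NCPowerSeries σ A) : 1 * f = f := by
  ext w
  rw [coeff_mul, Finset.sum_eq_single 0]
  · simp [coeff_one]
  · intro k hk hk0
    rw [coeff_one, if_neg, zero_mul]
    rw [Finset.mem_range] at hk
    rw [List.length_take]
    omega
  · simp

protected theorem mul_one [Semiring A] (f : NCPowerSeries σ A) : f * 1 = f := by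
  ext w
  rw [coeff_mul, Finset.sum_eq_single w.length]
  · simp [coeff_one]
  · intro k hk hk0
    rw [coeff_one, if_neg, mul_zero]
    rw [Finset.mem_range] at hk
    rw [List.length_drop]
    omega
  · simp

protected theorem mul_assoc [Semiring A] (f g h : NCPowerSeries σ A) :
    f * g * h = f * (g * h) := by
  ext w
  simp only [coeff_mul, Finset.sum_mul, Finset.mul_sum]
  rw [Finset.sum_sigma', Finset.sum_sigma']
  refine Finset.sum_bij' (fun p _ => ⟨p.2, p.1 - p.2⟩) (fun p _ => ⟨p.1 + p.2, p.1⟩) ?_ ?_ ?_ ?_ ?_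
  · rintro ⟨k, j⟩ hp
    simp only [Finset.mem_sigma, Finset.mem_range, List.length_take, List.length_drop] at hp ⊢
    omega
  · rintro ⟨k, j⟩ hp
    simp only [Finset.mem_sigma, Finset.mem_range, List.length_take, List.length_drop] at hp ⊢
    omega
  · rintro ⟨k, j⟩ hp
    simp only [Finset.mem_sigma, Finset.mem_range, List.length_take] at hp
    have : j + (k - j) = k := by omega
    simp [this]
  · rintro ⟨k, j⟩ hp
    simp
  · rintro ⟨k, j⟩ hp
    simp only [Finset.mem_sigma, Finset.mem_range, List.length_take] at hp
    have h1 : min j k = j := by omega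
    have h2 : j + (k - j) = k := by omega
    simp only [List.take_take, List.drop_drop, h1, h2, mul_assoc, List.drop_take]

instance [Semiring A] : Semiring (NCPowerSeries σ A) :=
  { (inferInstance : AddCommMonoid (NCPowerSeries σ A)),
    (inferInstance : One (NCPowerSeries σ A)),
    (inferInstance : Mul (NCPowerSeries σ A)) with
    one_mul := NCPowerSeries.one_mul
    mul_one := NCPowerSeries.mul_one
    mul_assoc := NCPowerSeries.mul_assoc
    zero_mul := fun f => by ext w; simp [coeff_mul]
    mul_zero := fun f => by ext w; simp [coeff_mul]
    left_distrib := fun f g h => by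
      ext w; simp [coeff_mul, mul_add, Finset.sum_add_distrib]
    right_distrib := fun f g h => by
      ext w; simp [coeff_mul, add_mul, Finset.sum_add_distrib] }

instance [Ring A] : Ring (NCPowerSeries σ A) :=
  { (inferInstance : Semiring (NCPowerSeries σ A)),
    (inferInstance : AddCommGroup (NCPowerSeries σ A)) with }

instance [CommSemiring R] [Semiring A] [Algebra R A] : Algebra R (NCPowerSeries σ A) :=
  Algebra.ofModule
    (fun r f g => by ext w; simp [coeff_mul, Finset.smul_sum])
    (fun r f g => by ext w; simp [coeff_mul, Finset.smul_sum])

/-- The variable `z_i`. -/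
def X [DecidableEq σ] [Semiring A] (i : σ) : NCPowerSeries σ A :=
  fun w => if w = [i] then 1 else 0

/-- The derivation `[u ∂/∂z] = ∑ i, [u_i ∂/∂z_i]`, the unique `R`-derivation with `z_i ↦ u_i`.
It replaces, in each word, each letter `z_i` in turn by `u_i`, so the coefficient of
a word `v` in `[u ∂/∂z] f` is the sum, over all ways to cut `v` into `p ++ q ++ s` and over all
letters `i`, of (coefficient of `p z_i s` in `f`) times (coefficient of `q` in `u_i`).
Here `p = v.take a`, `q = (v.drop a).take b` and `s = v.drop (a + b)`. -/
def derivationAlong [Fintype σ] [CommSemiring R] (u : σ → NCPowerSeries σ R)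
    (f : NCPowerSeries σ R) : NCPowerSeries σ R :=
  fun v => ∑ a ∈ Finset.range (v.length + 1), ∑ b ∈ Finset.range (v.length - a + 1), ∑ i : σ,
    coeff (v.take a ++ i :: v.drop (a + b)) f * coeff ((v.drop a).take b) (u i)

theorem coeff_derivationAlong [Fintype σ] [CommSemiring R] (u : σ → NCPowerSeries σ R)
    (f : NCPowerSeries σ R) (v : List σ) : coeff v (derivationAlong u f) =
  ∑ a ∈ Finset.range (v.length + 1), ∑ b ∈ Finset.range (v.length - a + 1), ∑ i : σ,
    coeff (v.take a ++ i :: v.drop (a + b)) f * coeff ((v.drop a).take b) (u i) := rfl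

/-- `[u ∂/∂z] z_i = u_i`. -/
theorem derivationAlong_X [Fintype σ] [DecidableEq σ] [CommSemiring R]
    (u : σ → NCPowerSeries σ R) (i : σ) : derivationAlong u (X i) = u i := by
  ext v
  have key : ∀ (a b : ℕ) (j : σ), coeff (v.take a ++ j :: v.drop (a + b)) (X i : NCPowerSeries σ R)
      = if (v.take a = [] ∧ j = i ∧ v.drop (a+b) = []) then 1 else 0 := by
    intro a b j
    change (if _ then _ else _) = _
    congr 1
    cases h : v.take a <;> simp
  rw [coeff_derivationAlong, Finset.sum_eq_single 0]
  · rw [Finset.sum_eq_single v.length]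
    · simp only [key]
      simp
    · intro b hb hb'
      refine Finset.sum_eq_zero fun j _ => ?_
      rw [key, if_neg, zero_mul]
      simp at hb ⊢
      omega
    · simp
  · intro a ha ha'
    refine Finset.sum_eq_zero fun b _ => Finset.sum_eq_zero fun j _ => ?_
    rw [key, if_neg, zero_mul]
    rintro ⟨h, -⟩
    have := congrArg List.length h
    simp at this ha
    rcases this with h | h
    · exact ha' h
    · subst h; simp at ha; exact ha' ha
  · simp

/-- `[u ∂/∂z]` satisfies the Leibniz rule. -/
theorem derivationAlong_mul [Fintype σ] [CommSemiring R] (u : σ → NCPowerSeries σ R)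
    (f g : NCPowerSeries σ R) :
    derivationAlong u (f * g) = derivationAlong u f * g + f * derivationAlong u g := by
  ext v
  have h1 : ∀ a ∈ Finset.range (v.length + 1), ∀ b ∈ Finset.range (v.length - a + 1), ∀ i : σ,
      coeff (v.take a ++ i :: v.drop (a + b)) (f * g) * coeff ((v.drop a).take b) (u i) =
      (∑ k ∈ Finset.range (a + 1), coeff (v.take k) f *
        (coeff ((v.drop k).take (a - k) ++ i :: v.drop (a + b)) g
          * coeff ((v.drop a).take b) (u i))) +
      ∑ k ∈ Finset.range (v.length - a - b + 1),
        coeff (v.take a ++ i :: (v.drop (a + b)).take k) f * coeff ((v.drop a).take b) (u i)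
          * coeff (v.drop (a + b + k)) g := by
    intro a ha b hb i
    simp only [Finset.mem_range] at ha hb
    have hl : (v.take a ++ i :: v.drop (a + b)).length + 1
        = (a + 1) + (v.length - a - b + 1) := by
      simp only [List.length_append, List.length_take, List.length_cons, List.length_drop]
      omega
    rw [coeff_mul, hl, Finset.sum_range_add, add_mul, Finset.sum_mul, Finset.sum_mul]
    have hla : (v.take a).length = a := by rw [List.length_take]; omega
    congr 1
    · refine Finset.sum_congr rfl fun k hk => ?_
      rw [Finset.mem_range] at hk
      rw [List.take_append_of_le_length (by omega), List.drop_append_of_le_length (by omega),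
        List.take_take, min_eq_left (by omega), mul_assoc, List.drop_take]
    · refine Finset.sum_congr rfl fun k hk => ?_
      have e1 : a + 1 + k - a = k + 1 := by omega
      have t1 : (v.take a ++ i :: v.drop (a + b)).take (a + 1 + k)
          = v.take a ++ i :: (v.drop (a + b)).take k := by
        rw [List.take_append, hla, e1, List.take_of_length_le (by omega), List.take_succ_cons]
      have t2 : (v.take a ++ i :: v.drop (a + b)).drop (a + 1 + k) = v.drop (a + b + k) := by
        rw [List.drop_append, hla, e1, List.drop_eq_nil_of_le (by omega), List.drop_succ_cons,
          List.drop_drop, List.nil_append]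
      rw [t1, t2]
      ring
  rw [coeff_add, coeff_derivationAlong, Finset.sum_congr rfl fun a ha =>
    Finset.sum_congr rfl fun b hb => Finset.sum_congr rfl fun i _ => h1 a ha b hb i]
  simp only [Finset.sum_add_distrib]
  rw [add_comm]
  congr 1
  · simp only [coeff_mul, coeff_derivationAlong, Finset.sum_mul]
    simp only [Finset.sum_sigma', Finset.univ_sigma_univ]
    refine Finset.sum_bij' (fun p _ => ⟨p.1 + p.2.1 + p.2.2.2, p.1, p.2.1, p.2.2.1⟩)
      (fun p _ => ⟨p.2.1, p.2.2.1, p.2.2.2, p.1 - p.2.1 - p.2.2.1⟩) ?_ ?_ ?_ ?_ ?_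
    · rintro ⟨a, b, i, k⟩ hp
      simp only [Finset.mem_sigma, Finset.mem_range, List.length_take, Finset.mem_univ,
        true_and, and_true] at hp ⊢
      omega
    · rintro ⟨a, b, i, k⟩ hp
      simp only [Finset.mem_sigma, Finset.mem_range, List.length_take, Finset.mem_univ,
        true_and, and_true] at hp ⊢
      omega
    · rintro ⟨a, b, i, k⟩ hp
      simp; omega
    · rintro ⟨k, a, b, i⟩ hp
      simp only [Finset.mem_sigma, Finset.mem_range, List.length_take, Finset.mem_univ,
        true_and, and_true] at hp ⊢
      simp; omega
    · rintro ⟨a, b, i, k⟩ hp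
      simp only [Finset.mem_sigma, Finset.mem_range, List.length_take, Finset.mem_univ,
        true_and, and_true] at hp ⊢
      have e1 : min a (a + b + k) = a := by omega
      have e2 : a + b + k - (a + b) = k := by omega
      have e3 : min b (a + b + k - a) = b := by omega
      simp only [List.take_take, List.drop_take, e1, e2, e3]
  · simp only [coeff_mul, coeff_derivationAlong, Finset.mul_sum]
    simp only [Finset.sum_sigma']
    refine Finset.sum_bij' (fun p _ => ⟨p.2.2.2, p.1 - p.2.2.2, p.2.1, p.2.2.1⟩)
      (fun p _ => ⟨p.1 + p.2.1, p.2.2.1, p.2.2.2, p.1⟩) ?_ ?_ ?_ ?_ ?_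
    · rintro ⟨a, b, i, k⟩ hp
      simp only [Finset.mem_sigma, Finset.mem_range, List.length_drop, Finset.mem_univ,
        true_and, and_true] at hp ⊢
      omega
    · rintro ⟨k, a, b, i⟩ hp
      simp only [Finset.mem_sigma, Finset.mem_range, List.length_drop, Finset.mem_univ,
        true_and, and_true] at hp ⊢
      omega
    · rintro ⟨a, b, i, k⟩ hp
      simp only [Finset.mem_sigma, Finset.mem_range, Finset.mem_univ,
        true_and, and_true] at hp ⊢
      simp; omega
    · rintro ⟨k, a, b, i⟩ hp
      simp
    · rintro ⟨a, b, i, k⟩ hp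
      simp only [Finset.mem_sigma, Finset.mem_range, Finset.mem_univ,
        true_and, and_true] at hp ⊢
      have e1 : k + (a - k) = a := by omega
      have e2 : k + (a - k + b) = a + b := by omega
      simp only [List.drop_drop, e1, e2]

end Basic

section Parameter

variable {σ K : Type*} [CommRing K]

/-- The inclusion `K⟨⟨z⟩⟩ ⊆ K[[t]]⟨⟨z⟩⟩`. -/
noncomputable def constT (f : NCPowerSeries σ K) : NCPowerSeries σ K⟦X⟧ :=
  fun w => PowerSeries.C (coeff w f)

/-- The coefficient in `K⟨⟨z⟩⟩` of `t ^ m` in an element of `K[[t]]⟨⟨z⟩⟩`. -/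
noncomputable def coeffT (m : ℕ) (f : NCPowerSeries σ K⟦X⟧) : NCPowerSeries σ K :=
  fun w => PowerSeries.coeff m (coeff w f)

/-- `N_{[m]}` for `m ≥ 1`: the coefficient of `t ^ m` in `G_t(z) - z`, where `G_t` is the inverse
of the automorphism `F_t`, and `G_t(z) = z + ∑ m ≥ 1, t ^ m N_{[m]}(z)`. -/
noncomputable def inverseCoeff [DecidableEq σ] (F : NCPowerSeries σ K⟦X⟧ ≃ₐ[K⟦X⟧] NCPowerSeries σ K⟦X⟧)
    (m : ℕ) (i : σ) : NCPowerSeries σ K :=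
  coeffT m (F.symm (X i) - X i)

end Parameter

end NCPowerSeries

namespace MvPowerSeries

variable {σ K : Type*} [CommRing K]

/-- The derivation `[u ∂/∂z] = ∑ i, u_i ∂/∂z_i` for commuting variables. -/
noncomputable def derivationAlong [Fintype σ] (u : σ → MvPowerSeries σ K)
    (f : MvPowerSeries σ K) : MvPowerSeries σ K :=
  ∑ i : σ, u i * pderiv K i f

/-- The inclusion `K[[z]] ⊆ K[[t]][[z]]`. -/
noncomputable def constT (f : MvPowerSeries σ K) : MvPowerSeries σ K⟦X⟧ :=
  map (PowerSeries.C : K →+* K⟦X⟧) f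

/-- The coefficient in `K[[z]]` of `t ^ m` in an element of `K[[t]][[z]]`. -/
noncomputable def coeffT (m : ℕ) (f : MvPowerSeries σ K⟦X⟧) : MvPowerSeries σ K :=
  fun d => PowerSeries.coeff m (coeff d f)

/-- `N_{[m]}` for `m ≥ 1`, for commuting variables. -/
noncomputable def inverseCoeff (F : MvPowerSeries σ K⟦X⟧ ≃ₐ[K⟦X⟧] MvPowerSeries σ K⟦X⟧)
    (m : ℕ) (i : σ) : MvPowerSeries σ K :=
  coeffT m (F.symm (X i) - X i)

end MvPowerSeries

/-- `π_u(I) = ∏ j, (i_1 + ⋯ + i_j)` for a composition `I = (i_1, …, i_k)`. -/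
def Composition.piU {m : ℕ} (I : Composition m) : ℕ :=
  ∏ j ∈ Finset.range I.length, I.sizeUpTo (j + 1)

/-- For `I = [i_1, …, i_k]` with `k ≥ 1`, the vector
`[N_{[i_1]} ∂/∂z] ⋯ [N_{[i_{k-1}]} ∂/∂z] N_{[i_k]}`, where `D u` is the derivation `[u ∂/∂z]`,
acting on each component. -/
def nestedDerivation {ι S : Type*} [Zero S] (D : (ι → S) → S → S) (N : ℕ → ι → S) :
    List ℕ → ι → S
  | [] => fun _ => 0
  | [k] => N k
  | i :: k :: l => fun j => D (N i) (nestedDerivation D N (k :: l) j)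

/-! Write `G` for the inverse of `F`. Applying `G` to `F z = z - t H` gives `G z = z + t M` with `M
= G(H)`, so `N_{m+1}` is the coefficient of `t ^ m` in `M`. The proof has an analytic and a
combinatorial half.

Analytic half (`burgers_of_inverse`): `M` satisfies `∂M/∂t = [M ∂/∂z] M`. Besides `∂/∂t` and `[M
∂/∂z]`, consider the conjugate `G ∘ ∂/∂t ∘ F`, which is again additive and Leibniz and sends `z_i`
to `-M_i`. Hence `∂/∂t - [M ∂/∂z] - G ∘ ∂/∂t ∘ F` kills the variables and the constants, so it
vanishes (`eq_zero_of_map_X_mul`). Evaluating it at `G z_i` and cancelling `t` gives the equation.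
Its coefficient of `t ^ (m - 2)` reads `(m - 1) N_m = ∑_{a + b = m} [N_a ∂/∂z] N_b`.

Combinatorial half (`sum_nestedDerivation`): let `S_m` be the weighted sum over all compositions of
`m`. The one-block term is `N_m / m`. Splitting off the first block of the others gives `(1/m) ∑
[N_a ∂/∂z] S_b`, which by induction and the recursion is `((m - 1)/m) N_m`. So `S_m = N_m`, and the
part with at least two blocks is `((m - 1)/m) N_m`, which is the claim. -/

/-! ### The Burgers equation for the inverse -/

theorem AlgEquiv.symm_sub_self {R A : Type*} [CommRing R] [Ring A] [Algebra R A] (F : A ≃ₐ[R] A)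
    {x h : A} {t : R} (hF : F x = x - t • h) : F.symm x - x = t • F.symm h := by
  have := congrArg F.symm hF
  rw [F.symm_apply_apply, map_sub, map_smul] at this
  exact sub_eq_iff_eq_add'.2 (sub_eq_iff_eq_add.1 this.symm)

/-- The inviscid Burgers equation `∂M/∂t = [M ∂/∂z] M` for the inverse `z + t M` of `z - t h`. Here
`dT` plays the role of `∂/∂t` and `δ` that of `[M ∂/∂z]`. -/
theorem burgers_of_inverse {ι R A : Type*} [CommRing R] [Ring A] [Algebra R A] (x h : ι → A)
    (hdet : ∀ Δ : A →+ A, (∀ r, Δ (algebraMap R A r) = 0) →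
      (∀ i f, Δ (x i * f) = x i * Δ f) → Δ = 0)
    (d : R → R) (dT δ : A →+ A) (t : R) (ht : d t = 1) (htA : ∀ f : A, t • f = 0 → f = 0)
    (hdT_mul : ∀ f g, dT (f * g) = dT f * g + f * dT g)
    (hdT_R : ∀ r, dT (algebraMap R A r) = algebraMap R A (d r))
    (hdT_x : ∀ i, dT (x i) = 0) (hdT_h : ∀ i, dT (h i) = 0)
    (F : A ≃ₐ[R] A) (hF : ∀ i, F (x i) = x i - t • h i)
    (hδ_mul : ∀ f g, δ (f * g) = δ f * g + f * δ g)
    (hδ_R : ∀ r, δ (algebraMap R A r) = 0) (hδ_x : ∀ i, δ (x i) = F.symm (h i)) (i : ι) :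
    dT (F.symm (h i)) = δ (F.symm (h i)) := by
  have hdT_smul : ∀ f : A, dT (t • f) = f + t • dT f := fun f => by
    rw [Algebra.smul_def, hdT_mul, hdT_R, ht, map_one, one_mul, ← Algebra.smul_def]
  have hδ_smul : ∀ f : A, δ (t • f) = t • δ f := fun f => by
    rw [Algebra.smul_def, hδ_mul, hδ_R, zero_mul, zero_add, ← Algebra.smul_def]
  have hx : ∀ i, F.symm (x i) = x i + t • F.symm (h i) := fun i =>
    sub_eq_iff_eq_add'.1 (F.symm_sub_self (hF i))
  -- The conjugate of `∂/∂t` by `F`; it satisfies the Leibniz rule because `F` is an automorphism.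
  let Q : A →+ A := (F.symm : A →+ A).comp (dT.comp (F : A →+ A))
  have hQ : ∀ f, Q f = F.symm (dT (F f)) := fun f => rfl
  have key : dT - δ - Q = 0 := by
    have hQx : ∀ i, Q (x i) = - F.symm (h i) := fun i => by
      rw [hQ, hF, map_sub, hdT_x, hdT_smul, hdT_h, smul_zero, add_zero, zero_sub, map_neg]
    refine hdet _ (fun r => ?_) fun i f => ?_
    · simp only [AddMonoidHom.sub_apply, hQ, hdT_R, hδ_R, AlgEquiv.commutes]
      abel
    · have hQm : Q (x i * f) = Q (x i) * f + x i * Q f := by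
        simp only [hQ, map_mul, hdT_mul, map_add, AlgEquiv.symm_apply_apply]
      simp only [AddMonoidHom.sub_apply, hQm, hQx, hdT_mul, hδ_mul, hdT_x, hδ_x]
      noncomm_ring
  -- At `F.symm (x i)` the conjugate contributes `F.symm (dT (x i)) = 0`, so only `dT` and `δ`
  -- remain.
  have h1 : dT (F.symm (x i)) - δ (F.symm (x i)) = 0 := by
    have := DFunLike.congr_fun key (F.symm (x i))
    rwa [AddMonoidHom.sub_apply, hQ, F.apply_symm_apply, hdT_x, map_zero, sub_zero] at this
  rw [hx, map_add, map_add, hdT_x, hδ_x, hdT_smul, hδ_smul, zero_add, add_sub_add_left_eq_sub,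
    ← smul_sub] at h1
  exact sub_eq_zero.1 (htA _ h1)

/-! ### Weighted sums over compositions -/

/-- Prepending a block to a composition. -/
def Composition.consBlock {m : ℕ} (a : ℕ) (I : Composition m) : Composition (a + 1 + m) where
  blocks := (a + 1) :: I.blocks
  blocks_pos := by
    intro i hi
    rcases List.mem_cons.1 hi with rfl | hi
    · omega
    · exact I.blocks_pos hi
  blocks_sum := by rw [List.sum_cons, I.blocks_sum]

/-- `π_u` of the reversal, as a function of the list of blocks. -/
def List.piURev (l : List ℕ) : ℕ :=
  ∏ j ∈ Finset.range l.length, (l.reverse.take (j + 1)).sum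

theorem Composition.piU_reverse {m : ℕ} (I : Composition m) :
    I.reverse.piU = I.blocks.piURev := by
  simp [Composition.piU, List.piURev, Composition.sizeUpTo, Composition.length]

/-- The factors are the sums of the nonempty suffixes of the list. A new head leaves the old
suffixes alone and adds one more, the whole list. -/
theorem List.piURev_cons (a : ℕ) (l : List ℕ) :
    (a :: l).piURev = l.piURev * (a + l.sum) := by
  rw [List.piURev, List.length_cons, Finset.prod_range_succ, List.piURev]
  congr 1
  · refine Finset.prod_congr rfl fun j hj => ?_
    rw [List.reverse_cons, List.take_append_of_le_length]
    simpa using Finset.mem_range.1 hj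
  · rw [List.take_of_length_le (by simp)]
    simp [add_comm]

/-- Compositions with at least two blocks, classified by their first block. -/
theorem Composition.sum_two_le_length {S : Type*} [AddCommMonoid S] (m : ℕ) (f : List ℕ → S) :
    ∑ I : Composition (m + 2) with 2 ≤ I.length, f I.blocks =
      ∑ p ∈ Finset.HasAntidiagonal.antidiagonal m, ∑ I : Composition (p.2 + 1), f ((p.1 + 1) :: I.blocks) := by
  rw [Finset.sum_sigma']
  symm
  -- Blocks are positive, so both the first block and the sum of the rest are shifted by one: they
  -- are `p.1 + 1` and `p.2 + 1`, with total `m + 2`.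
  refine Finset.sum_bij (fun p hp =>
    (p.2.consBlock p.1.1).cast (by
      have := Finset.HasAntidiagonal.mem_antidiagonal.1 (Finset.mem_sigma.1 hp).1
      omega)) ?_ ?_ ?_ ?_
  · rintro ⟨⟨a, b⟩, I⟩ hp
    simp only [Finset.mem_filter, Finset.mem_univ, true_and]
    have : 0 < I.length := I.length_pos_of_pos (Nat.succ_pos b)
    simp only [Composition.length, Composition.cast, Composition.consBlock, List.length_cons] at *
    omega
  · rintro ⟨⟨a, b⟩, I⟩ hp ⟨⟨a', b'⟩, I'⟩ hp' h
    have h := congrArg Composition.blocks h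
    simp only [Composition.cast, Composition.consBlock, List.cons.injEq] at h
    have h1 := Finset.HasAntidiagonal.mem_antidiagonal.1 (Finset.mem_sigma.1 hp).1
    have h2 := Finset.HasAntidiagonal.mem_antidiagonal.1 (Finset.mem_sigma.1 hp').1
    obtain ⟨h3, h4⟩ := h
    dsimp only at h1 h2
    obtain rfl : a = a' := by omega
    obtain rfl : b = b' := by omega
    obtain rfl : I = I' := Composition.ext h4
    rfl
  · rintro ⟨bl, hpos, hsum⟩ hI
    simp only [Finset.mem_filter, Finset.mem_univ, true_and, Composition.length] at hI
    rcases bl with _ | ⟨a, _ | ⟨b, l⟩⟩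
    · simp at hI
    · simp at hI
    have ha : 0 < a := hpos (by simp)
    have hb : 0 < b := hpos (by simp)
    simp only [List.sum_cons] at hsum
    refine ⟨⟨⟨a - 1, b + l.sum - 1⟩, ⟨b :: l, fun h => hpos (List.mem_cons_of_mem _ h), ?_⟩⟩,
      ?_, ?_⟩
    · rw [List.sum_cons]; omega
    · simp only [Finset.mem_sigma, Finset.mem_univ, and_true,
        Finset.HasAntidiagonal.mem_antidiagonal]
      omega
    · apply Composition.ext
      simp only [Composition.cast, Composition.consBlock, List.cons.injEq, and_true]
      omega
  · rintro ⟨⟨a, b⟩, I⟩ hp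
    rfl

theorem Composition.sum_eq_single_add {S : Type*} [AddCommMonoid S] (m : ℕ) (hm : 0 < m)
    (f : List ℕ → S) :
    ∑ I : Composition m, f I.blocks =
      f [m] + ∑ I : Composition m with 2 ≤ I.length, f I.blocks := by
  rw [← Finset.sum_filter_add_sum_filter_not _ (fun I : Composition m => 2 ≤ I.length), add_comm]
  congr 1
  rw [Finset.sum_eq_single (Composition.single m hm)]
  · rfl
  · intro I hI hne
    simp only [Finset.mem_filter, Finset.mem_univ, true_and] at hI
    have := I.length_pos_of_pos hm
    exact absurd ((Composition.eq_single_iff_length hm).2 (by omega)) hne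
  · intro h
    simp [Composition.single_length] at h

/-- An additive map between rational vector spaces is automatically `ℚ`-linear, so additivity is all
that is needed of `D`. -/
theorem map_sum_smul_of_additive {ι S : Type*} [AddCommGroup S] [Module ℚ S]
    (D : (ι → S) → S → S) (hD : ∀ u f g, D u (f + g) = D u f + D u g) (u : ι → S) {κ : Type*} (s : Finset κ) (c : κ → ℚ) (f : κ → S) :
    D u (∑ k ∈ s, c k • f k) = ∑ k ∈ s, c k • D u (f k) := by
  let E : S →+ S := AddMonoidHom.mk' (D u) (hD u)
  change E _ = ∑ k ∈ s, c k • E (f k)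
  rw [map_sum]
  exact Finset.sum_congr rfl fun k _ => map_rat_smul E _ _

theorem nestedDerivation_cons {ι S : Type*} [Zero S] (D : (ι → S) → S → S) (N : ℕ → ι → S)
    (a : ℕ) {l : List ℕ} (hl : l ≠ []) (j : ι) :
    nestedDerivation D N (a :: l) j = D (N a) (nestedDerivation D N l j) := by
  obtain ⟨b, l, rfl⟩ := List.exists_cons_of_ne_nil hl
  rfl

section NestedSum

variable {ι S : Type*} [AddCommGroup S] [Module ℚ S] (D : (ι → S) → S → S) (N : ℕ → ι → S)

/-- The full sum `m + 2` is a factor of every weight and comes out in front; what is left is the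
weight of the tail, and the outermost derivation depends on the first block alone. -/
theorem sum_two_le_length_nestedDerivation
    (hD : ∀ u f g, D u (f + g) = D u f + D u g) (m : ℕ) (j : ι) :
    ∑ I : Composition (m + 2) with 2 ≤ I.length,
      (1 / (I.blocks.piURev : ℚ)) • nestedDerivation D N I.blocks j =
    (1 / ((m : ℚ) + 2)) • ∑ p ∈ Finset.HasAntidiagonal.antidiagonal m, D (N (p.1 + 1))
      (∑ I : Composition (p.2 + 1),
        (1 / (I.blocks.piURev : ℚ)) • nestedDerivation D N I.blocks j) := by
  rw [Composition.sum_two_le_length m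
    (fun l => (1 / (l.piURev : ℚ)) • nestedDerivation D N l j), Finset.smul_sum]
  refine Finset.sum_congr rfl fun p hp => ?_
  rw [map_sum_smul_of_additive D hD, Finset.smul_sum]
  refine Finset.sum_congr rfl fun I _ => ?_
  have hI : I.blocks ≠ [] := fun h => by
    have := I.blocks_sum
    simp [h] at this
  rw [nestedDerivation_cons D N _ hI, smul_smul, List.piURev_cons, I.blocks_sum]
  have := Finset.HasAntidiagonal.mem_antidiagonal.1 hp
  congr 1
  have e : p.1 + 1 + (p.2 + 1) = m + 2 := by omega
  rw [e]
  push_cast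
  rw [one_div, one_div, one_div, mul_inv, mul_comm]

theorem sum_nestedDerivation (hD : ∀ u f g, D u (f + g) = D u f + D u g)
    (hN : ∀ (m : ℕ) j, ((m : ℚ) + 1) • N (m + 2) j =
      ∑ p ∈ Finset.HasAntidiagonal.antidiagonal m, D (N (p.1 + 1)) (N (p.2 + 1) j)) (j : ι) (m : ℕ) :
    ∑ I : Composition (m + 1),
      (1 / (I.blocks.piURev : ℚ)) • nestedDerivation D N I.blocks j = N (m + 1) j := by
  induction m using Nat.strong_induction_on with
  | _ m ih =>
    rw [Composition.sum_eq_single_add _ m.succ_pos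
      (fun l => (1 / (l.piURev : ℚ)) • nestedDerivation D N l j)]
    have h1 : [m + 1].piURev = m + 1 := by simp [List.piURev]
    have h2 : nestedDerivation D N [m + 1] j = N (m + 1) j := rfl
    rw [h1, h2]
    rcases m with _ | m
    -- The number `1` has no composition with two blocks.
    · rw [Finset.sum_eq_zero, add_zero]
      · simp
      · intro I hI
        have := I.length_le
        simp only [Finset.mem_filter] at hI
        omega
    · rw [sum_two_le_length_nestedDerivation D N hD, Finset.sum_congr rfl fun p hp => by
        rw [ih p.2 (by have := Finset.HasAntidiagonal.mem_antidiagonal.1 hp; omega)], ← hN, smul_smul, ← add_smul]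
      -- One block gives `1/(m + 2)`, the recursion gives `(m + 1)/(m + 2)`; they add up to `1`.
      convert one_smul ℚ _
      push_cast
      field_simp
      ring

/-- A sequence with `(m - 1) N_m = ∑_{a + b = m} D(N_a) N_b` satisfies the expansion over
compositions. -/
theorem eq_sum_nestedDerivation (hD : ∀ u f g, D u (f + g) = D u f + D u g)
    (hN : ∀ (m : ℕ) j, ((m : ℚ) + 1) • N (m + 2) j =
      ∑ p ∈ Finset.HasAntidiagonal.antidiagonal m, D (N (p.1 + 1)) (N (p.2 + 1) j)) {m : ℕ} (hm : 2 ≤ m)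
    (j : ι) :
    N m j = ((m : ℚ) / ((m : ℚ) - 1)) • ∑ I : Composition m with 2 ≤ I.length,
      (1 / (I.reverse.piU : ℚ)) • nestedDerivation D N I.blocks j := by
  obtain ⟨m, rfl⟩ := Nat.exists_eq_add_of_le' hm
  simp only [Composition.piU_reverse]
  rw [sum_two_le_length_nestedDerivation D N hD, Finset.sum_congr rfl fun p _ => by
    rw [sum_nestedDerivation D N hD hN], ← hN, smul_smul, smul_smul]
  symm
  convert one_smul ℚ _
  push_cast
  have : (m : ℚ) + 2 - 1 = m + 1 := by ring
  rw [this]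
  field_simp

end NestedSum

/-! ### Noncommutative variables -/

namespace NCPowerSeries

section Determinacy

variable {σ R S : Type*} [CommRing R] [CommRing S]

theorem coeff_algebraMap (r : R) (w : List σ) :
    coeff w (algebraMap R (NCPowerSeries σ R) r) = if w.length = 0 then r else 0 := by
  rw [Algebra.algebraMap_eq_smul_one, coeff_smul, coeff_one]
  simp

theorem coeff_sum {κ : Type*} (w : List σ) (s : Finset κ) (f : κ → NCPowerSeries σ R) :
    coeff w (∑ k ∈ s, f k) = ∑ k ∈ s, coeff w (f k) :=
  map_sum (AddMonoidHom.mk' (coeff w : NCPowerSeries σ R → R) (coeff_add w)) f s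

variable [DecidableEq σ]

theorem coeff_nil_X_mul (i : σ) (f : NCPowerSeries σ R) : coeff [] (X i * f) = 0 := by
  rw [coeff_mul]
  simp [coeff, X]

theorem coeff_cons_X_mul (i j : σ) (w : List σ) (f : NCPowerSeries σ R) :
    coeff (j :: w) (X i * f) = if j = i then coeff w f else 0 := by
  rw [coeff_mul, Finset.sum_eq_single 1]
  · simp [coeff, X]
  · intro k hk hk1
    rcases k with _ | _ | k
    · simp [coeff, X]
    · exact absurd rfl hk1
    · rcases w with _ | ⟨a, w⟩
      · simp at hk
      · simp [coeff, X]
  · simp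

theorem coeff_X (i : σ) (w : List σ) :
    coeff w (X i : NCPowerSeries σ R) = if w = [i] then 1 else 0 := rfl

/-- The series `f_i` in the decomposition `f = c + ∑ i, z_i f_i`. -/
def divX (i : σ) (f : NCPowerSeries σ R) : NCPowerSeries σ R := fun w => coeff (i :: w) f

theorem eq_algebraMap_add_sum_X_mul [Fintype σ] (f : NCPowerSeries σ R) :
    f = algebraMap R _ (coeff [] f) +
      ∑ i, X i * divX i f := by
  ext w
  rw [coeff_add, coeff_sum, coeff_algebraMap]
  rcases w with _ | ⟨j, w⟩
  · simp [coeff_nil_X_mul]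
  · simp only [coeff_cons_X_mul]
    simp [coeff, divX]

/-- Continuity of `Δ` is not needed: by the finite decomposition `f = c + ∑ i, z_i f_i`, the
coefficient of `z_j w` in `Δ f` is that of `w` in `Δ f_j`, and the word shrinks. Two coefficient
rings are allowed so that reduction modulo `t` is also covered. -/
theorem eq_zero_of_map_X_mul [Fintype σ] (Δ : NCPowerSeries σ R →+ NCPowerSeries σ S)
    (h0 : ∀ r, Δ (algebraMap R _ r) = 0) (hX : ∀ i f, Δ (X i * f) = X i * Δ f) : Δ = 0 := by
  have key : ∀ (w : List σ) (f : NCPowerSeries σ R), coeff w (Δ f) = 0 := by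
    intro w
    induction w with
    | nil =>
      intro f
      rw [eq_algebraMap_add_sum_X_mul f, map_add, h0, map_sum, coeff_add, coeff_sum]
      simp [hX, coeff_nil_X_mul]
    | cons j w ih =>
      intro f
      rw [eq_algebraMap_add_sum_X_mul f, map_add, h0, map_sum, coeff_add, coeff_sum]
      simp [hX, coeff_cons_X_mul, ih]
  exact DFunLike.ext _ _ fun f => ext fun w => key w f

end Determinacy

section Derivation

variable {σ R : Type*} [Fintype σ] [CommRing R]

theorem derivationAlong_add (u : σ → NCPowerSeries σ R) (f g : NCPowerSeries σ R) :
    derivationAlong u (f + g) = derivationAlong u f + derivationAlong u g := by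
  ext v
  simp only [coeff_add, coeff_derivationAlong, add_mul, Finset.sum_add_distrib]

theorem derivationAlong_algebraMap (u : σ → NCPowerSeries σ R) (r : R) :
    derivationAlong u (algebraMap R _ r) = 0 := by
  ext v
  simp [coeff_derivationAlong, coeff_algebraMap]

end Derivation

section Parameter

variable {σ K : Type*} [CommRing K]

theorem coeff_coeffT (m : ℕ) (f : NCPowerSeries σ K⟦X⟧) (w : List σ) :
    coeff w (coeffT m f) = PowerSeries.coeff m (coeff w f) := rfl

theorem coeff_constT (f : NCPowerSeries σ K) (w : List σ) :
    coeff w (constT f) = PowerSeries.C (coeff w f) := rfl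

theorem coeffT_add (m : ℕ) (f g : NCPowerSeries σ K⟦X⟧) :
    coeffT m (f + g) = coeffT m f + coeffT m g := by
  ext w
  simp [coeff_coeffT]

theorem coeffT_zero_mul (f g : NCPowerSeries σ K⟦X⟧) :
    coeffT 0 (f * g) = coeffT 0 f * coeffT 0 g := by
  ext w
  simp [coeff_coeffT, coeff_mul]

theorem coeffT_zero_X [DecidableEq σ] (i : σ) :
    coeffT 0 (X i : NCPowerSeries σ K⟦X⟧) = X i := by
  ext w
  rw [coeff_coeffT, coeff_X, coeff_X]
  split_ifs <;> simp

theorem coeffT_zero_constT (f : NCPowerSeries σ K) : coeffT 0 (constT f) = f := by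
  ext w
  simp [coeff_coeffT, coeff_constT]

theorem coeffT_zero_X_smul (f : NCPowerSeries σ K⟦X⟧) :
    coeffT 0 ((PowerSeries.X : K⟦X⟧) • f) = 0 := by
  ext w
  simp [coeff_coeffT]

theorem coeffT_succ_X_smul (m : ℕ) (f : NCPowerSeries σ K⟦X⟧) :
    coeffT (m + 1) ((PowerSeries.X : K⟦X⟧) • f) = coeffT m f := by
  ext w
  simp [coeff_coeffT, PowerSeries.coeff_succ_X_mul]

/-- Each coefficient of `derivationAlong u f` is bilinear in the coefficients of `u` and `f`, so
powers of `t` combine as in a Cauchy product. -/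
theorem coeffT_derivationAlong [Fintype σ] (m : ℕ) (u : σ → NCPowerSeries σ K⟦X⟧)
    (f : NCPowerSeries σ K⟦X⟧) :
    coeffT m (derivationAlong u f) = ∑ p ∈ Finset.HasAntidiagonal.antidiagonal m,
      derivationAlong (fun i => coeffT p.1 (u i)) (coeffT p.2 f) := by
  ext v
  rw [coeff_coeffT, coeff_sum]
  simp only [coeff_derivationAlong, map_sum, coeff_coeffT]
  symm
  rw [Finset.sum_comm]
  refine Finset.sum_congr rfl fun a _ => ?_
  rw [Finset.sum_comm]
  refine Finset.sum_congr rfl fun b _ => ?_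
  rw [Finset.sum_comm]
  refine Finset.sum_congr rfl fun i _ => ?_
  rw [mul_comm, PowerSeries.coeff_mul]
  exact Finset.sum_congr rfl fun p _ => mul_comm _ _

/-- Differentiation of the coefficients with respect to the parameter `t`. -/
noncomputable def derivT : NCPowerSeries σ K⟦X⟧ →+ NCPowerSeries σ K⟦X⟧ where
  toFun f := fun w => PowerSeries.derivative K (coeff w f)
  map_zero' := by ext1 w; exact map_zero (PowerSeries.derivative K)
  map_add' f g := by ext1 w; exact map_add (PowerSeries.derivative K) _ _

theorem coeff_derivT (f : NCPowerSeries σ K⟦X⟧) (w : List σ) :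
    coeff w (derivT f) = PowerSeries.derivative K (coeff w f) := rfl

theorem derivT_mul (f g : NCPowerSeries σ K⟦X⟧) :
    derivT (f * g) = derivT f * g + f * derivT g := by
  ext1 w
  simp only [coeff_derivT, coeff_add, coeff_mul, map_sum, Derivation.leibniz, smul_eq_mul,
    ← Finset.sum_add_distrib]
  refine Finset.sum_congr rfl fun k _ => ?_
  ring

theorem derivT_algebraMap (r : K⟦X⟧) :
    derivT (algebraMap _ (NCPowerSeries σ K⟦X⟧) r) = algebraMap _ _ (PowerSeries.derivative K r) := by
  ext1 w
  rw [coeff_derivT, coeff_algebraMap, coeff_algebraMap]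
  split_ifs <;> simp

theorem derivT_constT (f : NCPowerSeries σ K) : derivT (constT f) = 0 := by
  ext1 w
  simp [coeff_derivT, coeff_constT]

theorem derivT_X [DecidableEq σ] (i : σ) : derivT (X i : NCPowerSeries σ K⟦X⟧) = 0 := by
  ext1 w
  rw [coeff_derivT, coeff_X, coeff_zero]
  split_ifs
  · exact PowerSeries.derivative_one
  · exact map_zero (PowerSeries.derivative K)

theorem coeffT_derivT [Algebra ℚ K] (m : ℕ) (f : NCPowerSeries σ K⟦X⟧) :
    coeffT m (derivT f) = ((m : ℚ) + 1) • coeffT (m + 1) f := by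
  ext1 w
  rw [coeff_coeffT, coeff_derivT, PowerSeries.coeff_derivative, coeff_smul, coeff_coeffT,
    Algebra.smul_def, mul_comm]
  simp

theorem eq_zero_of_X_smul (f : NCPowerSeries σ K⟦X⟧) (h : (PowerSeries.X : K⟦X⟧) • f = 0) :
    f = 0 := by
  ext w m
  have := congrArg (fun g => coeff w (coeffT (m + 1) g)) h
  simpa [coeffT_succ_X_smul, coeff_coeffT] using this

section Inverse

variable [DecidableEq σ] (F : NCPowerSeries σ K⟦X⟧ ≃ₐ[K⟦X⟧] NCPowerSeries σ K⟦X⟧)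
  (H : σ → NCPowerSeries σ K)

/-- The relation `G z - z = t G(H)` shifts the index by one. -/
theorem inverseCoeff_succ (hF : ∀ i, F (X i) = X i - (PowerSeries.X : K⟦X⟧) • constT (H i))
    (m : ℕ) (i : σ) : inverseCoeff F (m + 1) i = coeffT m (F.symm (constT (H i))) := by
  rw [inverseCoeff, F.symm_sub_self (hF i), coeffT_succ_X_smul]

/-- The inverse of an automorphism `z - t H` is the identity modulo `t`. -/
theorem coeffT_zero_symm [Fintype σ] (hF : ∀ i, F (X i) = X i - (PowerSeries.X : K⟦X⟧) • constT (H i))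
    (f : NCPowerSeries σ K⟦X⟧) : coeffT 0 (F.symm f) = coeffT 0 f := by
  let E : NCPowerSeries σ K⟦X⟧ →+ NCPowerSeries σ K := AddMonoidHom.mk' (coeffT 0) (coeffT_add 0)
  have hE : ∀ f, E f = coeffT 0 f := fun f => rfl
  have hx : ∀ i, coeffT 0 (F.symm (X i)) = X i := fun i => by
    rw [sub_eq_iff_eq_add'.1 (F.symm_sub_self (hF i)), coeffT_add, coeffT_zero_X_smul, add_zero,
      coeffT_zero_X]
  -- The two maps agree on constants and multiply by the same `X i` when their argument is
  -- multiplied by `X i`; so does their difference.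
  have := eq_zero_of_map_X_mul (E.comp (F.symm : _ →+ _) - E) (fun r => ?_) fun i f => ?_
  · exact sub_eq_zero.1 (DFunLike.congr_fun this f)
  · change E (F.symm _) - E _ = 0
    rw [AlgEquiv.commutes, sub_self]
  · change E (F.symm _) - E _ = _ * (E (F.symm _) - E _)
    simp only [hE, map_mul, coeffT_zero_mul, hx, coeffT_zero_X, mul_sub]

theorem inverseCoeff_one [Fintype σ] (hF : ∀ i, F (X i) = X i - (PowerSeries.X : K⟦X⟧) • constT (H i)) :
    inverseCoeff F 1 = H := by
  funext i
  rw [inverseCoeff_succ F H hF, coeffT_zero_symm F H hF, coeffT_zero_constT]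

/-- This is the coefficient of `t ^ m` in the Burgers equation; the factor `m + 1` comes from
differentiating `t ^ (m + 1)`. -/
theorem inverseCoeff_recursion [Fintype σ] [Algebra ℚ K]
    (hF : ∀ i, F (X i) = X i - (PowerSeries.X : K⟦X⟧) • constT (H i)) (m : ℕ) (j : σ) :
    ((m : ℚ) + 1) • inverseCoeff F (m + 2) j = ∑ p ∈ Finset.HasAntidiagonal.antidiagonal m,
      derivationAlong (inverseCoeff F (p.1 + 1)) (inverseCoeff F (p.2 + 1) j) := by
  have := burgers_of_inverse X (fun i => constT (H i)) eq_zero_of_map_X_mul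
    (PowerSeries.derivative K) derivT
    (AddMonoidHom.mk' (derivationAlong fun i => F.symm (constT (H i))) (derivationAlong_add _))
    PowerSeries.X PowerSeries.derivative_X eq_zero_of_X_smul derivT_mul derivT_algebraMap derivT_X
    (fun i => derivT_constT _) F hF (derivationAlong_mul _) (derivationAlong_algebraMap _)
    (derivationAlong_X _) j
  have := congrArg (coeffT m) this
  rw [coeffT_derivT, AddMonoidHom.mk'_apply, coeffT_derivationAlong] at this
  rw [inverseCoeff_succ F H hF, this]
  refine Finset.sum_congr rfl fun p _ => ?_
  rw [inverseCoeff_succ F H hF, funext (inverseCoeff_succ F H hF p.1)]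

end Inverse

end Parameter

end NCPowerSeries

/-! ### Commutative variables -/

namespace MvPowerSeries

section Determinacy

variable {σ R S : Type*} [CommRing R] [CommRing S]

theorem coeff_X_mul_eq_ite (i : σ) (d : σ →₀ ℕ) (f : MvPowerSeries σ R) :
    coeff d (X i * f) =
      if Finsupp.single i 1 ≤ d then coeff (d - Finsupp.single i 1) f else 0 := by
  rw [X_def, coeff_monomial_mul]
  simp

theorem exists_eq_algebraMap_add_sum_X_mul [Fintype σ] (f : MvPowerSeries σ R) :
    ∃ (r : R) (g : σ → MvPowerSeries σ R), f = algebraMap R _ r + ∑ i, X i * g i := by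
  classical
  -- A monomial may be divisible by several variables. A single one is chosen for each nonconstant
  -- monomial, so that each enters exactly one `g i`.
  have hp : ∀ d : σ →₀ ℕ, ∃ i : Option σ, d ≠ 0 → ∃ j, i = some j ∧ Finsupp.single j 1 ≤ d := by
    intro d
    by_cases hd : d = 0
    · exact ⟨none, fun h => absurd hd h⟩
    · obtain ⟨j, hj⟩ := Finsupp.ne_iff.1 hd
      refine ⟨some j, fun _ => ⟨j, rfl, ?_⟩⟩
      rw [Finsupp.single_le_iff]
      exact Nat.one_le_iff_ne_zero.2 hj
  choose p hp using hp
  obtain ⟨g, hg⟩ : ∃ g : σ → MvPowerSeries σ R, ∀ i d, coeff d (g i) =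
      if p (d + Finsupp.single i 1) = some i then coeff (d + Finsupp.single i 1) f else 0 :=
    ⟨fun i d => _, fun i d => rfl⟩
  refine ⟨coeff 0 f, g, ?_⟩
  ext d
  rw [map_add, map_sum, algebraMap_apply, Algebra.algebraMap_self_apply, coeff_C]
  simp only [coeff_X_mul_eq_ite]
  by_cases hd : d = 0
  · subst hd
    rw [if_pos rfl, Finset.sum_eq_zero, add_zero]
    intro i _
    rw [if_neg]
    rw [Finsupp.single_le_iff]
    simp
  · obtain ⟨j, hj, hjd⟩ := hp d hd
    rw [if_neg hd, zero_add, Finset.sum_eq_single j, if_pos hjd]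
    · rw [hg, tsub_add_cancel_of_le hjd, if_pos hj]
    · intro i _ hij
      split_ifs with h
      · rw [hg, tsub_add_cancel_of_le h, if_neg]
        rw [hj]
        exact fun h => hij (Option.some.inj h).symm
      · rfl
    · simp

/-- As for words, with induction on the total degree: taking out a variable lowers the degree of the
coefficient in question by one. -/
theorem eq_zero_of_map_X_mul [Fintype σ] (Δ : MvPowerSeries σ R →+ MvPowerSeries σ S)
    (h0 : ∀ r, Δ (algebraMap R _ r) = 0) (hX : ∀ i f, Δ (X i * f) = X i * Δ f) : Δ = 0 := by
  have key : ∀ (k : ℕ) (d : σ →₀ ℕ), d.degree ≤ k → ∀ f : MvPowerSeries σ R,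
      coeff d (Δ f) = 0 := by
    intro k
    induction k with
    | zero =>
      intro d hd f
      obtain ⟨r, g, rfl⟩ := exists_eq_algebraMap_add_sum_X_mul f
      rw [map_add, h0, zero_add, map_sum, map_sum]
      refine Finset.sum_eq_zero fun i _ => ?_
      rw [hX, coeff_X_mul_eq_ite, if_neg]
      intro h
      have := Finsupp.degree_mono h
      simp at this
      omega
    | succ k ih =>
      intro d hd f
      obtain ⟨r, g, rfl⟩ := exists_eq_algebraMap_add_sum_X_mul f
      rw [map_add, h0, zero_add, map_sum, map_sum]
      refine Finset.sum_eq_zero fun i _ => ?_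
      rw [hX, coeff_X_mul_eq_ite]
      split_ifs with h
      · refine ih _ ?_ _
        have : (d - Finsupp.single i 1).degree + (Finsupp.single i 1).degree = d.degree := by
          rw [← map_add, tsub_add_cancel_of_le h]
        simp at this
        omega
      · rfl
  exact DFunLike.ext _ _ fun f => ext fun d => key _ d le_rfl f

end Determinacy

section Derivation

variable {σ R : Type*} [Fintype σ] [CommRing R]

theorem derivationAlong_add (u : σ → MvPowerSeries σ R) (f g : MvPowerSeries σ R) :
    derivationAlong u (f + g) = derivationAlong u f + derivationAlong u g := by
  simp only [derivationAlong, map_add, mul_add, Finset.sum_add_distrib]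

theorem derivationAlong_mul (u : σ → MvPowerSeries σ R) (f g : MvPowerSeries σ R) :
    derivationAlong u (f * g) = derivationAlong u f * g + f * derivationAlong u g := by
  simp only [derivationAlong, Derivation.leibniz, smul_eq_mul, Finset.sum_mul, Finset.mul_sum,
    ← Finset.sum_add_distrib]
  refine Finset.sum_congr rfl fun i _ => ?_
  ring

theorem derivationAlong_algebraMap (u : σ → MvPowerSeries σ R) (r : R) :
    derivationAlong u (algebraMap R _ r) = 0 := by
  simp [derivationAlong]

theorem derivationAlong_X (u : σ → MvPowerSeries σ R) (i : σ) :
    derivationAlong u (X i) = u i := by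
  rw [derivationAlong, Finset.sum_eq_single i]
  · rw [pderiv_X_self, mul_one]
  · intro j _ hj
    rw [pderiv_X_of_ne hj.symm, mul_zero]
  · simp

end Derivation

section Parameter

variable {σ K : Type*} [CommRing K]

theorem coeff_coeffT (m : ℕ) (f : MvPowerSeries σ K⟦X⟧) (d : σ →₀ ℕ) :
    coeff d (coeffT m f) = PowerSeries.coeff m (coeff d f) := rfl

theorem coeff_constT (f : MvPowerSeries σ K) (d : σ →₀ ℕ) :
    coeff d (constT f) = PowerSeries.C (coeff d f) := coeff_map _ _ _

theorem coeffT_add (m : ℕ) (f g : MvPowerSeries σ K⟦X⟧) :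
    coeffT m (f + g) = coeffT m f + coeffT m g := by
  ext d
  simp [coeff_coeffT]

theorem coeffT_sum {κ : Type*} (m : ℕ) (s : Finset κ) (f : κ → MvPowerSeries σ K⟦X⟧) :
    coeffT m (∑ k ∈ s, f k) = ∑ k ∈ s, coeffT m (f k) :=
  map_sum (AddMonoidHom.mk' (coeffT m) (coeffT_add m)) f s

theorem coeffT_mul (m : ℕ) (f g : MvPowerSeries σ K⟦X⟧) :
    coeffT m (f * g) =
      ∑ p ∈ Finset.HasAntidiagonal.antidiagonal m, coeffT p.1 f * coeffT p.2 g := by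
  classical
  ext d
  simp only [coeff_coeffT, coeff_mul, map_sum, PowerSeries.coeff_mul]
  exact Finset.sum_comm

theorem coeffT_zero_mul (f g : MvPowerSeries σ K⟦X⟧) :
    coeffT 0 (f * g) = coeffT 0 f * coeffT 0 g := by
  simp [coeffT_mul]

theorem coeffT_zero_X (i : σ) : coeffT 0 (X i : MvPowerSeries σ K⟦X⟧) = X i := by
  classical
  ext d
  rw [coeff_coeffT, coeff_X, coeff_X]
  split_ifs <;> simp

theorem coeffT_zero_constT (f : MvPowerSeries σ K) : coeffT 0 (constT f) = f := by
  ext d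
  simp [coeff_coeffT, coeff_constT]

theorem coeffT_zero_X_smul (f : MvPowerSeries σ K⟦X⟧) :
    coeffT 0 ((PowerSeries.X : K⟦X⟧) • f) = 0 := by
  ext d
  simp [coeff_coeffT]

theorem coeffT_succ_X_smul (m : ℕ) (f : MvPowerSeries σ K⟦X⟧) :
    coeffT (m + 1) ((PowerSeries.X : K⟦X⟧) • f) = coeffT m f := by
  ext d
  simp [coeff_coeffT, PowerSeries.coeff_succ_X_mul]

theorem coeffT_pderiv (m : ℕ) (i : σ) (f : MvPowerSeries σ K⟦X⟧) :
    coeffT m (pderiv _ i f) = pderiv _ i (coeffT m f) := by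
  ext d
  have : ((d i : K⟦X⟧) + 1) = PowerSeries.C ((d i : K) + 1) := by simp
  rw [coeff_coeffT, coeff_pderiv, coeff_pderiv, coeff_coeffT, this, PowerSeries.coeff_mul_C]

theorem coeffT_derivationAlong [Fintype σ] (m : ℕ) (u : σ → MvPowerSeries σ K⟦X⟧)
    (f : MvPowerSeries σ K⟦X⟧) :
    coeffT m (derivationAlong u f) = ∑ p ∈ Finset.HasAntidiagonal.antidiagonal m,
      derivationAlong (fun i => coeffT p.1 (u i)) (coeffT p.2 f) := by
  simp only [derivationAlong, coeffT_sum, coeffT_mul, coeffT_pderiv]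
  exact Finset.sum_comm

/-- Differentiation of the coefficients with respect to the parameter `t`. -/
noncomputable def derivT : MvPowerSeries σ K⟦X⟧ →+ MvPowerSeries σ K⟦X⟧ where
  toFun f := fun d => PowerSeries.derivative K (coeff d f)
  map_zero' := by ext1 d; exact map_zero (PowerSeries.derivative K)
  map_add' f g := by ext1 d; exact map_add (PowerSeries.derivative K) _ _

theorem coeff_derivT (f : MvPowerSeries σ K⟦X⟧) (d : σ →₀ ℕ) :
    coeff d (derivT f) = PowerSeries.derivative K (coeff d f) := rfl

theorem derivT_mul (f g : MvPowerSeries σ K⟦X⟧) :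
    derivT (f * g) = derivT f * g + f * derivT g := by
  classical
  ext1 d
  simp only [coeff_derivT, map_add, coeff_mul, map_sum, Derivation.leibniz, smul_eq_mul,
    ← Finset.sum_add_distrib]
  refine Finset.sum_congr rfl fun k _ => ?_
  ring

theorem derivT_algebraMap (r : K⟦X⟧) :
    derivT (algebraMap _ (MvPowerSeries σ K⟦X⟧) r) = algebraMap _ _ (PowerSeries.derivative K r) := by
  classical
  ext1 d
  rw [coeff_derivT, algebraMap_apply, algebraMap_apply, coeff_C, coeff_C]
  split_ifs <;> simp

theorem derivT_constT (f : MvPowerSeries σ K) : derivT (constT f) = 0 := by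
  ext1 d
  simp [coeff_derivT, coeff_constT]

theorem derivT_X (i : σ) : derivT (X i : MvPowerSeries σ K⟦X⟧) = 0 := by
  classical
  ext1 d
  rw [coeff_derivT, coeff_X, coeff_zero]
  split_ifs
  · exact PowerSeries.derivative_one
  · exact map_zero (PowerSeries.derivative K)

theorem coeffT_derivT [Algebra ℚ K] (m : ℕ) (f : MvPowerSeries σ K⟦X⟧) :
    coeffT m (derivT f) = ((m : ℚ) + 1) • coeffT (m + 1) f := by
  ext1 d
  change PowerSeries.coeff m (PowerSeries.derivative K (coeff d f)) =
    ((m : ℚ) + 1) • PowerSeries.coeff (m + 1) (coeff d f)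
  rw [PowerSeries.coeff_derivative, Algebra.smul_def, mul_comm]
  simp

theorem eq_zero_of_X_smul (f : MvPowerSeries σ K⟦X⟧) (h : (PowerSeries.X : K⟦X⟧) • f = 0) :
    f = 0 := by
  ext d m
  have := congrArg (fun g => coeff d (coeffT (m + 1) g)) h
  simpa [coeffT_succ_X_smul, coeff_coeffT] using this

section Inverse

variable (F : MvPowerSeries σ K⟦X⟧ ≃ₐ[K⟦X⟧] MvPowerSeries σ K⟦X⟧)
  (H : σ → MvPowerSeries σ K)

theorem inverseCoeff_succ (hF : ∀ i, F (X i) = X i - (PowerSeries.X : K⟦X⟧) • constT (H i))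
    (m : ℕ) (i : σ) : inverseCoeff F (m + 1) i = coeffT m (F.symm (constT (H i))) := by
  rw [inverseCoeff, F.symm_sub_self (hF i), coeffT_succ_X_smul]

/-- The inverse of an automorphism `z - t H` is the identity modulo `t`. -/
theorem coeffT_zero_symm [Fintype σ] (hF : ∀ i, F (X i) = X i - (PowerSeries.X : K⟦X⟧) • constT (H i))
    (f : MvPowerSeries σ K⟦X⟧) : coeffT 0 (F.symm f) = coeffT 0 f := by
  let E : MvPowerSeries σ K⟦X⟧ →+ MvPowerSeries σ K := AddMonoidHom.mk' (coeffT 0) (coeffT_add 0)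
  have hE : ∀ f, E f = coeffT 0 f := fun f => rfl
  have hx : ∀ i, coeffT 0 (F.symm (X i)) = X i := fun i => by
    rw [sub_eq_iff_eq_add'.1 (F.symm_sub_self (hF i)), coeffT_add, coeffT_zero_X_smul, add_zero,
      coeffT_zero_X]
  have := eq_zero_of_map_X_mul (E.comp (F.symm : _ →+ _) - E) (fun r => ?_) fun i f => ?_
  · exact sub_eq_zero.1 (DFunLike.congr_fun this f)
  · change E (F.symm _) - E _ = 0
    rw [AlgEquiv.commutes, sub_self]
  · change E (F.symm _) - E _ = _ * (E (F.symm _) - E _)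
    simp only [hE, map_mul, coeffT_zero_mul, hx, coeffT_zero_X, mul_sub]

theorem inverseCoeff_one [Fintype σ] (hF : ∀ i, F (X i) = X i - (PowerSeries.X : K⟦X⟧) • constT (H i)) :
    inverseCoeff F 1 = H := by
  funext i
  rw [inverseCoeff_succ F H hF, coeffT_zero_symm F H hF, coeffT_zero_constT]

theorem inverseCoeff_recursion [Fintype σ] [Algebra ℚ K]
    (hF : ∀ i, F (X i) = X i - (PowerSeries.X : K⟦X⟧) • constT (H i)) (m : ℕ) (j : σ) :
    ((m : ℚ) + 1) • inverseCoeff F (m + 2) j = ∑ p ∈ Finset.HasAntidiagonal.antidiagonal m,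
      derivationAlong (inverseCoeff F (p.1 + 1)) (inverseCoeff F (p.2 + 1) j) := by
  have := burgers_of_inverse X (fun i => constT (H i)) eq_zero_of_map_X_mul
    (PowerSeries.derivative K) derivT
    (AddMonoidHom.mk' (derivationAlong fun i => F.symm (constT (H i))) (derivationAlong_add _))
    PowerSeries.X PowerSeries.derivative_X eq_zero_of_X_smul derivT_mul derivT_algebraMap derivT_X
    (fun i => derivT_constT _) F hF (derivationAlong_mul _) (derivationAlong_algebraMap _)
    (derivationAlong_X _) j
  have := congrArg (coeffT m) this
  rw [coeffT_derivT, AddMonoidHom.mk'_apply, coeffT_derivationAlong] at this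
  rw [inverseCoeff_succ F H hF, this]
  refine Finset.sum_congr rfl fun p _ => ?_
  rw [inverseCoeff_succ F H hF, funext (inverseCoeff_succ F H hF p.1)]

end Inverse

end Parameter

end MvPowerSeries

/-! ### Both cases of the inversion formula -/

theorem mainTheorem9 {K : Type*} [CommRing K] [Algebra ℚ K] (n α : ℕ) (hα : 1 ≤ α) :
    -- noncommutative free variables
    (∀ (H : Fin n → NCPowerSeries (Fin n) K)
      (F : NCPowerSeries (Fin n) K⟦X⟧ ≃ₐ[K⟦X⟧] NCPowerSeries (Fin n) K⟦X⟧),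
      (∀ i, ∀ w : List (Fin n), w.length < α → NCPowerSeries.coeff w (H i) = 0) →
      (∀ i, F (NCPowerSeries.X i) =
        NCPowerSeries.X i - (PowerSeries.X : K⟦X⟧) • NCPowerSeries.constT (H i)) →
      NCPowerSeries.inverseCoeff F 1 = H ∧
      ∀ m : ℕ, 2 ≤ m → ∀ j : Fin n,
        NCPowerSeries.inverseCoeff F m j =
          ((m : ℚ) / ((m : ℚ) - 1)) •
            ∑ I : Composition m with 2 ≤ I.length,
              (1 / (I.reverse.piU : ℚ)) •
                nestedDerivation NCPowerSeries.derivationAlong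
                  (NCPowerSeries.inverseCoeff F) I.blocks j) ∧
    -- commutative variables
    (∀ (H : Fin n → MvPowerSeries (Fin n) K)
      (F : MvPowerSeries (Fin n) K⟦X⟧ ≃ₐ[K⟦X⟧] MvPowerSeries (Fin n) K⟦X⟧),
      (∀ i, (α : ℕ∞) ≤ (H i).order) →
      (∀ i, F (MvPowerSeries.X i) =
        MvPowerSeries.X i - (PowerSeries.X : K⟦X⟧) • MvPowerSeries.constT (H i)) →
      MvPowerSeries.inverseCoeff F 1 = H ∧
      ∀ m : ℕ, 2 ≤ m → ∀ j : Fin n,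
        MvPowerSeries.inverseCoeff F m j =
          ((m : ℚ) / ((m : ℚ) - 1)) •
            ∑ I : Composition m with 2 ≤ I.length,
              (1 / (I.reverse.piU : ℚ)) •
                nestedDerivation MvPowerSeries.derivationAlong
                  (MvPowerSeries.inverseCoeff F) I.blocks j) := by
  refine ⟨fun H F _ hF => ⟨NCPowerSeries.inverseCoeff_one F H hF, fun m hm j => ?_⟩,
    fun H F _ hF => ⟨MvPowerSeries.inverseCoeff_one F H hF, fun m hm j => ?_⟩⟩
  · exact eq_sum_nestedDerivation _ _ NCPowerSeries.derivationAlong_add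
      (NCPowerSeries.inverseCoeff_recursion F H hF) hm j
  · exact eq_sum_nestedDerivation _ _ MvPowerSeries.derivationAlong_add
      (MvPowerSeries.inverseCoeff_recursion F H hF) hm j
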